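/- Let $n\ge 2$ and $1<p,q<\infty$, and put $p'=p/(p-1)$. Let $u$ and $v$ be weights on $\mathbb{R}^n$, that is, non-negative locally integrable functions, and suppose that $w=v^{-p'/p}$ is locally integrable as well (with $w=\infty$ where $v=0$). For a measurable set $A$ write $u(A)=\int_A u$ and $w(A)=\int_A w$. For a bounded set $E$ that contains the origin let $E^\circ=\{z\in\mathbb{R}^n : |x\cdot z|\le 1 \text{ for all } x\in E\}$ be its polar. Rectanguloids and ellipsoids may have any orientation with respect to the coordinate axes and have non-empty interior; for $k>0$, $kA=\{kx : x\in A\}$. Consider the following statements. (i) There is a constant $C<\infty$ such that $u(R^\circ)^{1/q}\,w(nR)^{1/p'}\le C$ and $u(nR)^{1/q}\,w(R^\circ)^{1/p'}\le C$ for all rectanguloids $R$ centered at the origin. (ii) There is a constant $C<\infty$ such that $u(S^\circ)^{1/q}\,w(\sqrt n\,S)^{1/p'}\le C$ and $u(\sqrt n\,S)^{1/q}\,w(S^\circ)^{1/p'}\le C$ for all ellipsoids $S$ centered at the origin. (iii) There is a constant $C<\infty$ such that $u(E^\circ)^{1/q}\,w(E)^{1/p'}\le C$ and $u(E)^{1/q}\,w(E^\circ)^{1/p'}\le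 C$ for all bounded measurable sets $E$ that contain the origin and have non-empty interior. Then (i) implies (ii), and (ii) implies (iii). Suppose moreover that there is a constant $0<c<\infty$ such that $c^{-1}u(A)\le u(\sqrt n\,A)\le c\,u(A)$ and $c^{-1}w(A)\le w(\sqrt n\,A)\le c\,w(A)$ for all rectanguloids and all ellipsoids $A$ centered at the origin. Then (i), (ii) and (iii) are equivalent. -/

import Mathlib

open MeasureTheory
open scoped ENNReal NNReal Pointwise

noncomputable section

namespace FourierWeights

/-- The polar of `E`: the set of all `z` such that `|x · z| ≤ 1` for all `x ∈ E`. -/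
def polar {n : ℕ} (E : Set (EuclideanSpace ℝ (Fin n))) : Set (EuclideanSpace ℝ (Fin n)) :=
  (innerₗ (EuclideanSpace ℝ (Fin n))).polar E

/-- Rectanguloids with non-empty interior, centered at the origin, of any orientation:
`b` gives the directions of the edges, `a i > 0` are the half edge lengths. -/
def IsRectanguloid {n : ℕ} (R : Set (EuclideanSpace ℝ (Fin n))) : Prop :=
  ∃ (b : OrthonormalBasis (Fin n) ℝ (EuclideanSpace ℝ (Fin n))) (a : Fin n → ℝ),
    (∀ i, 0 < a i) ∧ R = {x | ∀ i, |inner ℝ (b i) x| ≤ a i}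

/-- Ellipsoids with non-empty interior, centered at the origin, of any orientation:
`b` gives the directions of the principal axes, `a i > 0` are the lengths of the semi-axes. -/
def IsEllipsoid {n : ℕ} (S : Set (EuclideanSpace ℝ (Fin n))) : Prop :=
  ∃ (b : OrthonormalBasis (Fin n) ℝ (EuclideanSpace ℝ (Fin n))) (a : Fin n → ℝ),
    (∀ i, 0 < a i) ∧ S = {x | ∑ i, (inner ℝ (b i) x / a i) ^ 2 ≤ 1}

/-- A weight is a non-negative, locally integrable function. -/
def IsWeight {n : ℕ} (u : EuclideanSpace ℝ (Fin n) → ℝ) : Prop :=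
  (∀ x, 0 ≤ u x) ∧ LocallyIntegrable u volume

/-- `w = v ^ (-p' / p)` with `p' = p / (p - 1)`. It takes its values in `[0, ∞]`, so that it is
`∞` where `v` is `0`. -/
def dualWeight {n : ℕ} (p : ℝ) (v : EuclideanSpace ℝ (Fin n) → ℝ)
    (x : EuclideanSpace ℝ (Fin n)) : ℝ≥0∞ :=
  ENNReal.ofReal (v x) ^ (-(p.conjExponent / p))

/-- `f(A) = ∫_A f`, the integral over `A` with respect to Lebesgue measure. -/
def mass {n : ℕ} (f : EuclideanSpace ℝ (Fin n) → ℝ≥0∞)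
    (A : Set (EuclideanSpace ℝ (Fin n))) : ℝ≥0∞ :=
  ∫⁻ x in A, f x

/-- The two inequalities `u(A)^{1/q} w(B)^{1/p'} ≤ C` and `u(B)^{1/q} w(A)^{1/p'} ≤ C`. -/
def Testing {n : ℕ} (p q : ℝ) (u w : EuclideanSpace ℝ (Fin n) → ℝ≥0∞) (C : ℝ≥0)
    (A B : Set (EuclideanSpace ℝ (Fin n))) : Prop :=
  mass u A ^ (1 / q) * mass w B ^ (1 / p.conjExponent) ≤ C ∧
    mass u B ^ (1 / q) * mass w A ^ (1 / p.conjExponent) ≤ C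

/-- The testing condition over rectanguloids. -/
def RectanguloidCondition {n : ℕ} (p q : ℝ) (u w : EuclideanSpace ℝ (Fin n) → ℝ≥0∞) : Prop :=
  ∃ C : ℝ≥0, ∀ R : Set (EuclideanSpace ℝ (Fin n)), IsRectanguloid R →
    Testing p q u w C (polar R) ((n : ℝ) • R)

/-- The testing condition over ellipsoids. -/
def EllipsoidCondition {n : ℕ} (p q : ℝ) (u w : EuclideanSpace ℝ (Fin n) → ℝ≥0∞) : Prop :=
  ∃ C : ℝ≥0, ∀ S : Set (EuclideanSpace ℝ (Fin n)), IsEllipsoid S →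
    Testing p q u w C (polar S) (√(n : ℝ) • S)

/-- The testing condition over all bounded (Lebesgue) measurable sets that contain the origin and
have non-empty interior. -/
def SetCondition {n : ℕ} (p q : ℝ) (u w : EuclideanSpace ℝ (Fin n) → ℝ≥0∞) : Prop :=
  ∃ C : ℝ≥0, ∀ E : Set (EuclideanSpace ℝ (Fin n)),
    Bornology.IsBounded E → NullMeasurableSet E volume → 0 ∈ E → (interior E).Nonempty →
      Testing p q u w C (polar E) E

/-- `f(√n A) ≈ f(A)` for all rectanguloids and ellipsoids `A` centered at the origin. -/
def DilationComparable {n : ℕ} (f : EuclideanSpace ℝ (Fin n) → ℝ≥0∞) : Prop :=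
  ∃ c : ℝ≥0, ∀ A : Set (EuclideanSpace ℝ (Fin n)), IsRectanguloid A ∨ IsEllipsoid A →
    mass f (√(n : ℝ) • A) ≤ c * mass f A ∧ mass f A ≤ c * mass f (√(n : ℝ) • A)

end FourierWeights

end

open FourierWeights

/-!
The testing inequalities are monotone in both sets, so an implication between two of the
conditions follows once each set `E` of one family is matched with a set `F` of the other such that
`polar E ⊆ polar F` and the dilates are nested the right way.

An ellipsoid with semi-axes `a i` contains the box with half edges `a i / √n` and is contained in
the box with half edges `a i`; this gives ellipsoids from rectanguloids
(`IsEllipsoid.exists_isRectanguloid`).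

To pass from ellipsoids to an arbitrary bounded set `E` with interior, an ellipsoid `S` is needed
with `E ⊆ √n S` and `polar E ⊆ polar S` (`exists_isEllipsoid_polar`). This is John's theorem for
symmetric convex bodies. Working with `P = polar E`, a bounded neighbourhood of `0`, avoids convex
hulls and the bipolar theorem. Among the positive semidefinite matrices `G` with `z · G z ≤ 1` on `P`,
which form a compact set, take one of maximal determinant. If some `x ∈ E` had `s = x · G⁻¹ x > n`,
then `(1 - t) G + t x xᵀ` would be admissible too, because `|x · z| ≤ 1` on `P`, while its determinant is
`(1 - t) ^ n (1 + t s / (1 - t)) det G > det G` for small `t > 0` (`exists_posDef_loewner`). In an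
eigenbasis of `G`, the ellipsoid `S = {x | x · G⁻¹ x ≤ 1}` has the required form, and
`P ⊆ polar S` is the Cauchy–Schwarz inequality.

Conversely a rectanguloid is itself an admissible set `E`, and comparability under dilation by `√n`,
used twice, replaces `R` by `n R`.
-/

open MeasureTheory
open scoped ENNReal NNReal Pointwise

namespace FourierWeights

/-! ### The ellipsoid of extremal determinant -/

section Loewner

open Matrix

/-- The right-hand side is the factor by which the determinant grows from `G` to
`(1 - t) G + t x xᵀ` when `x · G⁻¹ x = s`; its derivative at `t = 0` is `s - N`. -/
theorem exists_one_lt_pow_mul {N : ℕ} {s : ℝ} (hs : (N : ℝ) < s) :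
    ∃ t : ℝ, 0 < t ∧ t < 1 ∧ 1 < (1 - t) ^ N * (1 + t / (1 - t) * s) := by
  have hN : (0 : ℝ) ≤ N := N.cast_nonneg
  have hs0 : 0 < s := hN.trans_lt hs
  -- By Bernoulli the factor exceeds `1` as soon as `N * t * (s - 1) < s - N`.
  obtain ⟨t, ht0, ht1, ht⟩ : ∃ t : ℝ, 0 < t ∧ t < 1 ∧ 0 < (s - N) - N * t * (s - 1) := by
    have hc : Filter.Tendsto (fun t : ℝ => (s - N) - N * t * (s - 1)) (nhdsWithin 0 (Set.Ioi 0))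
        (nhds (s - N)) := by
      have : Continuous fun t : ℝ => (s - N) - N * t * (s - 1) := by fun_prop
      simpa using (this.tendsto 0).mono_left nhdsWithin_le_nhds
    have h1 := hc.eventually (lt_mem_nhds (sub_pos.2 hs))
    have h2 : ∀ᶠ t : ℝ in nhdsWithin 0 (Set.Ioi 0), t ∈ Set.Ioo (0 : ℝ) 1 :=
      Ioo_mem_nhdsGT one_pos
    obtain ⟨t, h, h'⟩ := (h1.and h2).exists
    exact ⟨t, h'.1, h'.2, h⟩
  refine ⟨t, ht0, ht1, ?_⟩
  have h1t : 0 < 1 - t := sub_pos.2 ht1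
  have hb : 1 - N * t ≤ (1 - t) ^ N := by
    have := one_add_mul_le_pow (a := -t) (by linarith) N
    rw [← sub_eq_add_neg] at this
    linarith
  have hk : 1 + t / (1 - t) * s = (1 + t * (s - 1)) / (1 - t) := by
    field_simp
    ring
  rw [hk, mul_div_assoc', one_lt_div h1t]
  have hnn : 0 ≤ 1 + t * (s - 1) := by nlinarith
  calc 1 - t < (1 - N * t) * (1 + t * (s - 1)) := by nlinarith
    _ ≤ (1 - t) ^ N * (1 + t * (s - 1)) := by gcongr

variable {ι : Type*} [Fintype ι]

theorem det_smul_add_smul_vecMulVec [DecidableEq ι] {G : Matrix ι ι ℝ} (hG : IsUnit G.det)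
    {t : ℝ} (ht : t < 1) (x : ι → ℝ) :
    ((1 - t) • G + t • vecMulVec x x).det =
      (1 - t) ^ Fintype.card ι * (1 + t / (1 - t) * (x ⬝ᵥ G⁻¹ *ᵥ x)) * G.det := by
  have h1 : 1 - t ≠ 0 := by linarith
  have : (1 - t) • G + t • vecMulVec x x =
      (1 - t) • (G + replicateCol Unit ((t / (1 - t)) • x) * replicateRow Unit x) := by
    rw [smul_add, ← vecMulVec_eq, smul_vecMulVec, smul_smul, mul_div_cancel₀ _ h1]
  rw [this, det_smul, det_add_replicateCol_mul_replicateRow hG]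
  have h2 : (replicateRow Unit x * G⁻¹ * replicateCol Unit ((t / (1 - t)) • x)) default default =
      t / (1 - t) * (x ⬝ᵥ G⁻¹ *ᵥ x) := by
    rw [Matrix.mul_assoc, ← replicateCol_mulVec, replicateRow_mul_replicateCol_apply, mulVec_smul,
      dotProduct_smul, smul_eq_mul]
  rw [det_unique (n := Unit), Matrix.add_apply, one_apply_eq, h2]
  ring

theorem dotProduct_vecMulVec_mulVec (x z : ι → ℝ) : z ⬝ᵥ vecMulVec x x *ᵥ z = (x ⬝ᵥ z) ^ 2 := by
  simp [vecMulVec_mulVec, dotProduct_comm z x, sq]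

theorem single_dotProduct_mulVec_single [DecidableEq ι] (G : Matrix ι ι ℝ) (i j : ι) (c d : ℝ) :
    Pi.single i c ⬝ᵥ G *ᵥ Pi.single j d = c * d * G i j := by
  simp [mulVec_single]
  ring

/-- The positive semidefinite matrices `G` with `z · G z ≤ 1` on `P`: for positive definite `G`,
this says that the ellipsoid `{z | z · G z ≤ 1}` contains `P`. -/
def feasible (P : Set (ι → ℝ)) : Set (Matrix ι ι ℝ) :=
  {G | G.PosSemidef ∧ ∀ z ∈ P, z ⬝ᵥ G *ᵥ z ≤ 1}

theorem isClosed_feasible (P : Set (ι → ℝ)) : IsClosed (feasible P) := by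
  have : feasible P = {G : Matrix ι ι ℝ | Gᵀ = G} ∩ (⋂ x : ι → ℝ, {G | 0 ≤ x ⬝ᵥ G *ᵥ x}) ∩
      ⋂ z ∈ P, {G | z ⬝ᵥ G *ᵥ z ≤ 1} := by
    ext G
    simp [feasible, posSemidef_iff_dotProduct_mulVec, IsHermitian,
      conjTranspose_eq_transpose_of_trivial]
  rw [this]
  refine ((isClosed_eq (by fun_prop) (by fun_prop)).inter
    (isClosed_iInter fun x => isClosed_le (by fun_prop) (by fun_prop))).inter
    (isClosed_biInter fun z _ => isClosed_le (by fun_prop) (by fun_prop))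

/-- If `P` contains a ball then the diagonal entries of a feasible matrix are bounded, and so are all
entries by positivity on `e i ± e j`. -/
theorem isCompact_feasible {P : Set (ι → ℝ)} (hP : P ∈ nhds 0) : IsCompact (feasible P) := by
  obtain ⟨r, hr, hrP⟩ := Metric.nhds_basis_closedBall.mem_iff.1 hP
  have hbox : IsCompact (Set.univ.pi fun _ : ι => Set.univ.pi fun _ : ι =>
      Set.Icc (-(r ^ 2)⁻¹) ((r ^ 2)⁻¹)) :=
    isCompact_univ_pi fun _ => isCompact_univ_pi fun _ => isCompact_Icc
  refine IsCompact.of_isClosed_subset hbox (isClosed_feasible P) ?_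
  rintro G ⟨hG, hGP⟩ i - j -
  classical
  have hdiag (k : ι) : G k k ≤ (r ^ 2)⁻¹ := by
    have := hGP (Pi.single k r) (hrP (by
      rw [mem_closedBall_zero_iff, Pi.norm_single, Real.norm_of_nonneg hr.le]))
    rw [single_dotProduct_mulVec_single] at this
    rw [← one_div, le_div_iff₀ (by positivity)]
    linarith
  have hsymm : G j i = G i j := by simpa using hG.1.apply i j
  have hquad (c : ℝ) := hG.dotProduct_mulVec_nonneg (Pi.single i 1 + Pi.single j c)
  simp only [star_trivial, mulVec_add, add_dotProduct, dotProduct_add,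
    single_dotProduct_mulVec_single, hsymm] at hquad
  have := hquad 1
  have := hquad (-1)
  -- `2 |G i j| ≤ G i i + G j j` for positive semidefinite `G`, also when `i = j`.
  constructor <;> linarith [hdiag i, hdiag j]

/-- The extremal ellipsoid in matrix form. `G` maximises the determinant among the feasible matrices,
that is, `{z | z · G z ≤ 1}` is the ellipsoid of least volume containing `P`. The bound on the polar
of `P` is the first-order condition: for `x` in the polar, `(1 - t) G + t x xᵀ` is feasible as well. -/
theorem exists_posDef_loewner [DecidableEq ι] {P : Set (ι → ℝ)} (hP : P ∈ nhds 0)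
    (hPb : Bornology.IsBounded P) :
    ∃ G : Matrix ι ι ℝ, G.PosDef ∧ (∀ z ∈ P, z ⬝ᵥ G *ᵥ z ≤ 1) ∧
      ∀ x, (∀ z ∈ P, |x ⬝ᵥ z| ≤ 1) → x ⬝ᵥ G⁻¹ *ᵥ x ≤ Fintype.card ι := by
  obtain ⟨ε, hε, hεP⟩ : ∃ ε : ℝ, 0 < ε ∧ ε • (1 : Matrix ι ι ℝ) ∈ feasible P := by
    obtain ⟨M, hM⟩ := hPb.exists_norm_le
    have hε : 0 < Fintype.card ι * M ^ 2 + 1 := by positivity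
    refine ⟨(Fintype.card ι * M ^ 2 + 1)⁻¹, inv_pos.2 hε, PosSemidef.one.smul (inv_pos.2 hε).le,
      fun z hz => ?_⟩
    have hz2 : z ⬝ᵥ z ≤ Fintype.card ι * M ^ 2 := by
      calc z ⬝ᵥ z = ∑ i, z i ^ 2 := Finset.sum_congr rfl fun i _ => (sq _).symm
        _ ≤ ∑ _i : ι, M ^ 2 := Finset.sum_le_sum fun i _ =>
          sq_le_sq' (abs_le.1 ((norm_le_pi_norm z i).trans (hM z hz))).1
            (abs_le.1 ((norm_le_pi_norm z i).trans (hM z hz))).2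
        _ = Fintype.card ι * M ^ 2 := by simp
    rw [smul_mulVec, one_mulVec, dotProduct_smul, smul_eq_mul, inv_mul_le_one₀ hε]
    linarith
  -- The multiple of the identity guarantees that the maximum of the determinant is positive.
  obtain ⟨G, ⟨hGp, hGP⟩, hmax⟩ := (isCompact_feasible hP).exists_isMaxOn ⟨_, hεP⟩
    (continuous_id.matrix_det.continuousOn)
  have hdet : 0 < G.det := by
    refine lt_of_lt_of_le ?_ (hmax hεP)
    simp only [id, det_smul, det_one, mul_one]
    positivity
  have hGd : G.PosDef := hGp.posDef_iff_det_ne_zero.2 hdet.ne'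
  refine ⟨G, hGd, hGP, fun x hx => ?_⟩
  by_contra! hlt
  obtain ⟨t, ht0, ht1, ht⟩ := exists_one_lt_pow_mul hlt
  have hmem : (1 - t) • G + t • vecMulVec x x ∈ feasible P := by
    have hv := posSemidef_vecMulVec_self_star x
    rw [star_trivial] at hv
    refine ⟨(hGp.smul (sub_nonneg.2 ht1.le)).add (hv.smul ht0.le), fun z hz => ?_⟩
    have h1 := hGP z hz
    have h2 : (x ⬝ᵥ z) ^ 2 ≤ 1 := (sq_le_one_iff_abs_le_one _).2 (hx z hz)
    simp only [add_mulVec, smul_mulVec, dotProduct_add, dotProduct_smul,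
      dotProduct_vecMulVec_mulVec, smul_eq_mul]
    nlinarith
  have := hmax hmem
  simp only [Set.mem_ofPred_eq, id, det_smul_add_smul_vecMulVec hdet.ne'.isUnit ht1] at this
  nlinarith

/-- A quadratic form in coordinates with respect to an orthonormal eigenbasis. -/
theorem dotProduct_mulVec_eq_sum {A : Matrix ι ι ℝ} (hA : A.IsHermitian)
    (b : OrthonormalBasis ι ℝ (EuclideanSpace ℝ ι)) {μ : ι → ℝ}
    (h : ∀ i, A *ᵥ (b i).ofLp = μ i • (b i).ofLp) (x : EuclideanSpace ℝ ι) :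
    x.ofLp ⬝ᵥ A *ᵥ x.ofLp = ∑ i, μ i * inner ℝ (b i) x ^ 2 := by
  have hi (i) : inner ℝ (b i) (WithLp.toLp 2 (A *ᵥ x.ofLp)) = μ i * inner ℝ (b i) x := by
    rw [EuclideanSpace.inner_eq_star_dotProduct, EuclideanSpace.inner_eq_star_dotProduct]
    have : A *ᵥ x.ofLp ⬝ᵥ (b i).ofLp = x.ofLp ⬝ᵥ A *ᵥ (b i).ofLp := by
      rw [dotProduct_mulVec, ← mulVec_transpose, ← conjTranspose_eq_transpose_of_trivial, hA.eq]
    simp [this, h i]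
  calc x.ofLp ⬝ᵥ A *ᵥ x.ofLp = inner ℝ x (WithLp.toLp 2 (A *ᵥ x.ofLp)) := by
        rw [EuclideanSpace.inner_eq_star_dotProduct, dotProduct_comm]; simp
    _ = ∑ i, inner ℝ x (b i) * inner ℝ (b i) (WithLp.toLp 2 (A *ᵥ x.ofLp)) :=
        (b.sum_inner_mul_inner _ _).symm
    _ = _ := Finset.sum_congr rfl fun i _ => by rw [hi, real_inner_comm]; ring

/-- The extremal ellipsoid of `exists_posDef_loewner` along its principal axes. -/
theorem exists_orthonormalBasis_loewner [DecidableEq ι] {P : Set (EuclideanSpace ℝ ι)}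
    (hP : P ∈ nhds 0) (hPb : Bornology.IsBounded P) :
    ∃ (b : OrthonormalBasis ι ℝ (EuclideanSpace ℝ ι)) (a : ι → ℝ), (∀ i, 0 < a i) ∧
      (∀ z ∈ P, ∑ i, (a i * inner ℝ (b i) z) ^ 2 ≤ 1) ∧
      ∀ x, (∀ z ∈ P, |inner ℝ x z| ≤ 1) →
        ∑ i, (inner ℝ (b i) x / a i) ^ 2 ≤ Fintype.card ι := by
  obtain ⟨G, hG, hGP, hGx⟩ := exists_posDef_loewner (P := WithLp.ofLp '' P)
    ((EuclideanSpace.equiv ι ℝ).toHomeomorph.isOpenMap.image_mem_nhds hP)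
    ((EuclideanSpace.equiv ι ℝ).lipschitz.isBounded_image hPb)
  have hpos := hG.eigenvalues_pos
  refine ⟨hG.1.eigenvectorBasis, fun i => √(hG.1.eigenvalues i), fun i => Real.sqrt_pos.2 (hpos i),
    fun z hz => ?_, fun x hx => ?_⟩
  · refine le_trans (le_of_eq ?_) (hGP z.ofLp ⟨z, hz, rfl⟩)
    rw [dotProduct_mulVec_eq_sum hG.1 _ hG.1.mulVec_eigenvectorBasis]
    exact Finset.sum_congr rfl fun i _ => by rw [mul_pow, Real.sq_sqrt (hpos i).le]
  · have hinv (i) : G⁻¹ *ᵥ (hG.1.eigenvectorBasis i).ofLp =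
        (hG.1.eigenvalues i)⁻¹ • (hG.1.eigenvectorBasis i).ofLp := by
      have h := congrArg (G⁻¹ *ᵥ ·) (hG.1.mulVec_eigenvectorBasis i)
      simp only [mulVec_mulVec, mulVec_smul,
        nonsing_inv_mul _ ((isUnit_iff_isUnit_det _).1 hG.isUnit),
        one_mulVec] at h
      rw [eq_inv_smul_iff₀ (hpos i).ne', ← h]
    refine le_trans (le_of_eq ?_) (hGx x.ofLp ?_)
    · rw [dotProduct_mulVec_eq_sum hG.inv.1 _ hinv]
      exact Finset.sum_congr rfl fun i _ => by
        rw [div_pow, Real.sq_sqrt (hpos i).le, div_eq_inv_mul]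
    · rintro _ ⟨z, hz, rfl⟩
      have := hx z hz
      rwa [EuclideanSpace.inner_eq_star_dotProduct, dotProduct_comm] at this

end Loewner

/-! ### Polars -/

variable {n : ℕ}

theorem mem_polar_iff {E : Set (EuclideanSpace ℝ (Fin n))} {z : EuclideanSpace ℝ (Fin n)} :
    z ∈ polar E ↔ ∀ x ∈ E, |inner ℝ x z| ≤ 1 := Iff.rfl

theorem polar_anti {E F : Set (EuclideanSpace ℝ (Fin n))} (h : E ⊆ F) : polar F ⊆ polar E :=
  (innerₗ (EuclideanSpace ℝ (Fin n))).polar_antitone h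

theorem polar_mem_nhds {E : Set (EuclideanSpace ℝ (Fin n))} (hE : Bornology.IsBounded E) :
    polar E ∈ nhds 0 := by
  obtain ⟨M, hM0, hM⟩ := hE.exists_pos_norm_le
  refine Filter.mem_of_superset (Metric.closedBall_mem_nhds 0 (inv_pos.2 hM0)) fun z hz x hx => ?_
  rw [mem_closedBall_zero_iff] at hz
  calc |inner ℝ x z| ≤ ‖x‖ * ‖z‖ := abs_real_inner_le_norm x z
    _ ≤ M * M⁻¹ := by gcongr; exact hM x hx
    _ = 1 := mul_inv_cancel₀ hM0.ne'

theorem isBounded_polar {E : Set (EuclideanSpace ℝ (Fin n))} (hE : (interior E).Nonempty) :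
    Bornology.IsBounded (polar E) := by
  obtain ⟨x₀, hx₀⟩ := hE
  obtain ⟨r, hr, hrE⟩ := Metric.nhds_basis_closedBall.mem_iff.1 (mem_interior_iff_mem_nhds.1 hx₀)
  refine isBounded_iff_forall_norm_le.2 ⟨2 / r, fun z hz => ?_⟩
  rcases eq_or_ne z 0 with rfl | hz0
  · simp; positivity
  have hzn : 0 < ‖z‖ := norm_pos_iff.2 hz0
  -- Compare `z` with the centre `x₀` and with the boundary point `x₀ + r z / ‖z‖`.
  have h0 := mem_polar_iff.1 hz x₀ (hrE (Metric.mem_closedBall_self hr.le))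
  have h1 := mem_polar_iff.1 hz (x₀ + (r / ‖z‖) • z) (hrE (by
    rw [mem_closedBall_iff_norm, add_sub_cancel_left, norm_smul, Real.norm_of_nonneg (by positivity),
      div_mul_cancel₀ _ hzn.ne']))
  rw [inner_add_left, real_inner_smul_left, real_inner_self_eq_norm_sq] at h1
  have h2 : r / ‖z‖ * ‖z‖ ^ 2 = r * ‖z‖ := by field_simp
  rw [h2] at h1
  rw [le_div_iff₀ hr]
  linarith [(abs_le.1 h0).1, (abs_le.1 h1).2]

/-! ### Comparison of sets, ellipsoids and rectanguloids -/

/-- John's theorem for symmetric convex bodies, stated through the polar so that `E` need be neither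
convex nor symmetric. -/
theorem exists_isEllipsoid_polar {E : Set (EuclideanSpace ℝ (Fin n))} (hn : 0 < n)
    (hEb : Bornology.IsBounded E) (hEi : (interior E).Nonempty) :
    ∃ S, IsEllipsoid S ∧ E ⊆ √(n : ℝ) • S ∧ polar E ⊆ polar S := by
  obtain ⟨b, a, ha, hP, hE⟩ := exists_orthonormalBasis_loewner (polar_mem_nhds hEb)
    (isBounded_polar hEi)
  have hn' : (0 : ℝ) < n := Nat.cast_pos.2 hn
  refine ⟨_, ⟨b, a, ha, rfl⟩, fun x hx => ?_, fun z hz x hx => ?_⟩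
  · have h := hE x fun z hz => mem_polar_iff.1 hz x hx
    rw [Set.mem_smul_set_iff_inv_smul_mem₀ (Real.sqrt_pos.2 hn').ne']
    simp only [Set.mem_ofPred_eq, real_inner_smul_right, mul_div_assoc, mul_pow, ← Finset.mul_sum,
      inv_pow, Real.sq_sqrt hn'.le]
    rw [inv_mul_le_one₀ hn']
    simpa using h
  · have h1 := hP z hz
    rw [innerₗ_apply_apply, Real.norm_eq_abs, ← sq_le_one_iff_abs_le_one]
    calc (inner ℝ x z) ^ 2
        = (∑ i, (inner ℝ (b i) x / a i) * (a i * inner ℝ (b i) z)) ^ 2 := by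
          rw [← b.sum_inner_mul_inner]
          congr 1
          refine Finset.sum_congr rfl fun i _ => ?_
          have := (ha i).ne'
          rw [real_inner_comm]
          field_simp
      _ ≤ (∑ i, (inner ℝ (b i) x / a i) ^ 2) * ∑ i, (a i * inner ℝ (b i) z) ^ 2 :=
          Finset.sum_mul_sq_le_sq_mul_sq _ _ _
      _ ≤ 1 := mul_le_one₀ hx (by positivity) h1

/-- `R` is the largest dilate, by `1 / √n`, of the circumscribed box that still fits into `S`. -/
theorem IsEllipsoid.exists_isRectanguloid {S : Set (EuclideanSpace ℝ (Fin n))} (hn : 0 < n)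
    (hS : IsEllipsoid S) :
    ∃ R, IsRectanguloid R ∧ R ⊆ S ∧ √(n : ℝ) • S ⊆ (n : ℝ) • R := by
  obtain ⟨b, a, ha, rfl⟩ := hS
  have hn' : (0 : ℝ) < n := Nat.cast_pos.2 hn
  have hs : 0 < √(n : ℝ) := Real.sqrt_pos.2 hn'
  refine ⟨_, ⟨b, fun i => a i / √n, fun i => div_pos (ha i) hs, rfl⟩, fun x hx => ?_, ?_⟩
  · have h (i) : (inner ℝ (b i) x / a i) ^ 2 ≤ (n : ℝ)⁻¹ := by
      have := hx i
      rw [← Real.sq_sqrt hn'.le, ← inv_pow, sq_le_sq, abs_div, abs_of_pos (ha i),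
        abs_of_pos (inv_pos.2 hs), div_le_iff₀ (ha i), inv_mul_eq_div]
      exact this
    calc ∑ i, (inner ℝ (b i) x / a i) ^ 2 ≤ ∑ _i : Fin n, (n : ℝ)⁻¹ :=
          Finset.sum_le_sum fun i _ => h i
      _ = 1 := by simp [hn'.ne']
  · rintro _ ⟨x, hx, rfl⟩
    rw [Set.mem_smul_set_iff_inv_smul_mem₀ hn'.ne']
    intro i
    have h1 : (inner ℝ (b i) x / a i) ^ 2 ≤ 1 :=
      (Finset.single_le_sum (f := fun i => (inner ℝ (b i) x / a i) ^ 2)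
        (fun i _ => sq_nonneg _) (Finset.mem_univ i)).trans hx
    rw [sq_le_one_iff_abs_le_one, abs_div, abs_of_pos (ha i), div_le_one (ha i)] at h1
    have h2 : (n : ℝ)⁻¹ * √n = (√n)⁻¹ := by
      rw [← div_eq_inv_mul, Real.sqrt_div_self]
    simp only [smul_smul, real_inner_smul_right, h2, abs_mul, abs_of_pos (inv_pos.2 hs)]
    rw [inv_mul_eq_div]
    gcongr

/-! ### Rectanguloids as admissible sets -/

theorem IsRectanguloid.smul {R : Set (EuclideanSpace ℝ (Fin n))} (hR : IsRectanguloid R) {k : ℝ}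
    (hk : 0 < k) : IsRectanguloid (k • R) := by
  obtain ⟨b, a, ha, rfl⟩ := hR
  refine ⟨b, fun i => k * a i, fun i => mul_pos hk (ha i), ?_⟩
  ext x
  rw [Set.mem_smul_set_iff_inv_smul_mem₀ hk.ne']
  simp only [Set.mem_ofPred_eq, real_inner_smul_right, abs_mul, abs_of_pos (inv_pos.2 hk),
    inv_mul_le_iff₀ hk]

theorem IsRectanguloid.isClosed {R : Set (EuclideanSpace ℝ (Fin n))} (hR : IsRectanguloid R) :
    IsClosed R := by
  obtain ⟨b, a, ha, rfl⟩ := hR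
  simp only [Set.ofPred_forall]
  exact isClosed_iInter fun i => isClosed_le (by fun_prop) (by fun_prop)

theorem IsRectanguloid.isBounded {R : Set (EuclideanSpace ℝ (Fin n))} (hR : IsRectanguloid R) :
    Bornology.IsBounded R := by
  obtain ⟨b, a, ha, rfl⟩ := hR
  refine isBounded_iff_forall_norm_le.2 ⟨∑ i, a i, fun x hx => ?_⟩
  rw [← b.sum_repr' x]
  refine (norm_sum_le _ _).trans (Finset.sum_le_sum fun i _ => ?_)
  rw [norm_smul, b.norm_eq_one, mul_one]
  exact hx i

theorem IsRectanguloid.mem_nhds {R : Set (EuclideanSpace ℝ (Fin n))} (hR : IsRectanguloid R) :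
    R ∈ nhds 0 := by
  obtain ⟨b, a, ha, rfl⟩ := hR
  simp only [Set.ofPred_forall]
  refine Filter.iInter_mem.2 fun i => ?_
  have hc : Continuous fun x : EuclideanSpace ℝ (Fin n) => |inner ℝ (b i) x| := by fun_prop
  have := hc.tendsto 0
  simp only [inner_zero_right, abs_zero] at this
  exact this.eventually (ge_mem_nhds (ha i))

/-! ### The testing conditions -/

variable {p q : ℝ} {u w f : EuclideanSpace ℝ (Fin n) → ℝ≥0∞}

theorem mass_mono {A B : Set (EuclideanSpace ℝ (Fin n))} (h : A ⊆ B) : mass f A ≤ mass f B :=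
  lintegral_mono_set h

theorem Testing.mono (hp : 1 < p) (hq : 1 < q) {C : ℝ≥0} {A B A' B' : Set (EuclideanSpace ℝ (Fin n))}
    (h : Testing p q u w C A' B') (hA : A ⊆ A') (hB : B ⊆ B') : Testing p q u w C A B := by
  have hp' : 0 ≤ 1 / p.conjExponent := (Real.HolderConjugate.conjExponent hp).symm.one_div_nonneg
  have hq' : 0 ≤ 1 / q := by positivity
  refine ⟨le_trans ?_ h.1, le_trans ?_ h.2⟩ <;>
    gcongr ?_ ^ _ * ?_ ^ _ <;> exact mass_mono (by assumption)

theorem RectanguloidCondition.ellipsoidCondition (hn : 0 < n) (hp : 1 < p) (hq : 1 < q)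
    (h : RectanguloidCondition p q u w) : EllipsoidCondition p q u w := by
  obtain ⟨C, hC⟩ := h
  refine ⟨C, fun S hS => ?_⟩
  obtain ⟨R, hR, hRS, hSR⟩ := hS.exists_isRectanguloid hn
  exact (hC R hR).mono hp hq (polar_anti hRS) hSR

theorem EllipsoidCondition.setCondition (hn : 0 < n) (hp : 1 < p) (hq : 1 < q)
    (h : EllipsoidCondition p q u w) : SetCondition p q u w := by
  obtain ⟨C, hC⟩ := h
  refine ⟨C, fun E hEb _ _ hEi => ?_⟩
  obtain ⟨S, hS, hES, hSE⟩ := exists_isEllipsoid_polar hn hEb hEi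
  exact (hC S hS).mono hp hq hSE hES

/-- Dilation by `n` is dilation by `√n` twice, and `√n • R` is again a rectanguloid. -/
theorem DilationComparable.exists_mass_smul_le (hn : 0 < n) (hf : DilationComparable f) :
    ∃ c : ℝ≥0, ∀ R, IsRectanguloid R → mass f ((n : ℝ) • R) ≤ c * mass f R := by
  obtain ⟨c, hc⟩ := hf
  refine ⟨c * c, fun R hR => ?_⟩
  have hs : 0 < √(n : ℝ) := Real.sqrt_pos.2 (Nat.cast_pos.2 hn)
  have h1 := (hc _ (.inl (hR.smul hs))).1
  have h2 := (hc R (.inl hR)).1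
  rw [smul_smul, Real.mul_self_sqrt n.cast_nonneg] at h1
  calc mass f ((n : ℝ) • R) ≤ c * mass f (√(n : ℝ) • R) := h1
    _ ≤ c * (c * mass f R) := by gcongr
    _ = _ := by rw [ENNReal.coe_mul, mul_assoc]

theorem SetCondition.rectanguloidCondition (hn : 0 < n) (hp : 1 < p) (hq : 1 < q)
    (hu : DilationComparable u) (hw : DilationComparable w)
    (h : SetCondition p q u w) : RectanguloidCondition p q u w := by
  obtain ⟨C, hC⟩ := h
  obtain ⟨c, hc⟩ := hu.exists_mass_smul_le hn
  obtain ⟨d, hd⟩ := hw.exists_mass_smul_le hn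
  have hp' : 0 ≤ 1 / p.conjExponent := (Real.HolderConjugate.conjExponent hp).symm.one_div_nonneg
  have hq' : 0 ≤ 1 / q := by positivity
  refine ⟨max (d ^ (1 / p.conjExponent) * C) (c ^ (1 / q) * C), fun R hR => ?_⟩
  have h := hC R hR.isBounded hR.isClosed.measurableSet.nullMeasurableSet
    (mem_of_mem_nhds hR.mem_nhds) ⟨0, mem_interior_iff_mem_nhds.2 hR.mem_nhds⟩
  constructor
  · calc mass u (polar R) ^ (1 / q) * mass w ((n : ℝ) • R) ^ (1 / p.conjExponent)
        ≤ mass u (polar R) ^ (1 / q) * (d * mass w R) ^ (1 / p.conjExponent) := by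
          gcongr
          exact hd R hR
      _ = d ^ (1 / p.conjExponent) *
          (mass u (polar R) ^ (1 / q) * mass w R ^ (1 / p.conjExponent)) := by
          rw [ENNReal.mul_rpow_of_nonneg _ _ hp', mul_left_comm]
      _ ≤ ((d ^ (1 / p.conjExponent) * C : ℝ≥0) : ℝ≥0∞) := by
          rw [ENNReal.coe_mul, ENNReal.coe_rpow_of_nonneg _ hp']
          gcongr
          exact h.1
      _ ≤ _ := ENNReal.coe_le_coe.2 (le_max_left _ _)
  · calc mass u ((n : ℝ) • R) ^ (1 / q) * mass w (polar R) ^ (1 / p.conjExponent)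
        ≤ (c * mass u R) ^ (1 / q) * mass w (polar R) ^ (1 / p.conjExponent) := by
          gcongr
          exact hc R hR
      _ = c ^ (1 / q) *
          (mass u R ^ (1 / q) * mass w (polar R) ^ (1 / p.conjExponent)) := by
          rw [ENNReal.mul_rpow_of_nonneg _ _ hq', mul_assoc]
      _ ≤ ((c ^ (1 / q) * C : ℝ≥0) : ℝ≥0∞) := by
          rw [ENNReal.coe_mul, ENNReal.coe_rpow_of_nonneg _ hq']
          gcongr
          exact h.2
      _ ≤ _ := ENNReal.coe_le_coe.2 (le_max_right _ _)

end FourierWeights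

theorem theorem2 (n : ℕ) (hn : 2 ≤ n) (p q : ℝ) (hp : 1 < p) (hq : 1 < q)
    (u v : EuclideanSpace ℝ (Fin n) → ℝ) (hu : IsWeight u) (hv : IsWeight v)
    (hw : LocallyIntegrable (dualWeight p v) volume) :
    (RectanguloidCondition p q (fun x => ENNReal.ofReal (u x)) (dualWeight p v) →
      EllipsoidCondition p q (fun x => ENNReal.ofReal (u x)) (dualWeight p v)) ∧
    (EllipsoidCondition p q (fun x => ENNReal.ofReal (u x)) (dualWeight p v) →
      SetCondition p q (fun x => ENNReal.ofReal (u x)) (dualWeight p v)) ∧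
    (DilationComparable (fun x => ENNReal.ofReal (u x)) →
      DilationComparable (dualWeight p v) →
      List.TFAE [RectanguloidCondition p q (fun x => ENNReal.ofReal (u x)) (dualWeight p v),
        EllipsoidCondition p q (fun x => ENNReal.ofReal (u x)) (dualWeight p v),
        SetCondition p q (fun x => ENNReal.ofReal (u x)) (dualWeight p v)]) := by
  have hn0 : 0 < n := by omega
  refine ⟨fun h => h.ellipsoidCondition hn0 hp hq, fun h => h.setCondition hn0 hp hq,
    fun hu' hw' => ?_⟩
  tfae_have 1 → 2 := fun h => h.ellipsoidCondition hn0 hp hq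
  tfae_have 2 → 3 := fun h => h.setCondition hn0 hp hq
  tfae_have 3 → 1 := fun h => h.rectanguloidCondition hn0 hp hq hu' hw'
  tfae_finish
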